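/- Let $S$ (states) and $A$ (labels) be finite groups and let $B\le S\times A\times S$ be a subdirect product (a group trellis section; its elements $b=(b^-,a,b^+)$ are branches). Let $C$ be the group of all sequences $(b_t)_{t\in\mathbb Z}$ in $B$ with $b_t^+=b_{t+1}^-$ for all $t$, and for $I\subseteq\mathbb Z$ let $C_I$ be the subgroup of those sequences that are the identity outside $I$. Suppose that $C$ is controllable and let $\ell\ge1$ be the least positive integer such that any state at any time $t$ is joined by a path in $C$ to any state at time $t+\ell$. Put $X_j=\{b_j:(b_t)\in C_{[0,\infty)}\}$, $Y_i=\{b_{-i-1}:(b_t)\in C_{(-\infty,0)}\}$ and $\Delta_k=X_0\cap Y_k$, for $H\le B$ put $\mathcal N(H)=\{e\in B: e^-=b^+\text{ for some }b\in H\}$, and for $0\le j\le k\le\ell$ let $Q_{j,k}=\mathcal N^j(\Delta_k)/\mathcal N^j(\Delta_{k-1})$ and $U_{j,k}=\{0,1,\dots,|Q_{j,k}|-1\}$. A generator basis is a triangular array of sets $[r_{j,k}]\subseteq B$, $0\le j\le k\le\ell$, obtained as follows: for every $k\le\ell$ choose a set of representatives (generators) of the cosets of $C_{[0,k)}C_{(0,k]}$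 in $C_{[0,k]}$, the trivial coset being represented by the identity sequence, and let $[r_{j,k}]$ be the set of the time-$j$ components of the chosen generators. The vector basis formed from it consists, for $0\le j\le\ell$, of the set of all products $x_j=r_{j,j}r_{j,j+1}\cdots r_{j,\ell}$ with one factor from each $[r_{j,k}]$. Let $\mathcal D_{\mathbf U}$ be the directed graph (parallel edges allowed) whose edges are the triangular arrays $(u_{j,k})_{0\le j\le k\le\ell}$ with $u_{j,k}\in U_{j,k}$ and whose nodes are the arrays $(u_{j,k})_{1\le j\le k\le\ell}$ with $u_{j,k}\in U_{j,k}$; the edge $(u_{j,k})$ goes from the node $(u_{j,k})_{1\le j\le k\le\ell}$ to the node whose entry in position $(j,k)$ is $u_{j-1,k}$. An automorphism is a pair of a permutation of the nodes and a permutation of the edges that respects endpoints, and $\mathrm{Aut}(\mathcal D_{\mathbf U})$ is the set of these pairs. Theorem. The number of generator bases of $B$ is at most $|\mathrm{Aut}(\mathcal D_{\mathbf U})|$, and it is also at most $$\prod_{k=0}^{\ell}\bigl(|U_{0,k}|!\bigr)^{\Upsilon_k},\qquad \Upsilon_k=\prod_{k'=k+1}^{\ell}|U_{0,k'}|^{\,k'-k}\quad(\Upsilon_\ell=1).$$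 Here $$|\mathrm{Aut}(\mathcal D_{\mathbf U})|=\prod_{k=0}^{\ell}\bigl(|U_{0,k}|!\bigr)^{\prod_{k'=k+1}^{\ell}|U_{0,k'}|^{\,k'-k+1}}.$$ The number of distinct vector bases formed from generator bases is at most the number of generator bases, so the same bounds hold for it. -/

import Mathlib

/-- A group trellis section: a subdirect product `branch` of `S × A × S`, where `S` is the
state group and `A` is the label group.  A branch is a triple `(s, a, s')`. -/
structure GroupTrellis (S A : Type*) [Group S] [Group A] where
  branch : Subgroup (S × A × S)
  left_surj : ∀ s : S, ∃ b ∈ branch, b.1 = s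
  label_surj : ∀ a : A, ∃ b ∈ branch, b.2.1 = a
  right_surj : ∀ s : S, ∃ b ∈ branch, b.2.2 = s

/-- A directed graph with nodes `V` and edges `E` (parallel edges and loops are allowed):
`endpoints e a b` says that the edge `e` has the ordered pair of endpoints `(a, b)`. -/
structure DirectedGraph (V E : Type*) where
  endpoints : E → V → V → Prop

/-- The automorphisms of a directed graph: pairs of a permutation of the nodes and a permutation
of the edges such that if `e` has endpoints `(a, b)` then the image of `e` has as endpoints the
images of `a` and `b`. -/
def DirectedGraph.Aut {V E : Type*} (D : DirectedGraph V E) :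
    Set (Equiv.Perm V × Equiv.Perm E) :=
  {φ | ∀ e a b, D.endpoints e a b → D.endpoints (φ.2 e) (φ.1 a) (φ.1 b)}

/-- Positions `(j, k)`, `0 ≤ j ≤ k ≤ ℓ`, of the triangular arrays (column `j`, row `k`). -/
abbrev TriIndex (ℓ : ℕ) : Type := {p : ℕ × ℕ // p.1 ≤ p.2 ∧ p.2 ≤ ℓ}

/-- The positions in columns `1, …, ℓ`; the element `(j, k)` stands for the position
`(j + 1, k)`. -/
abbrev TailIndex (ℓ : ℕ) : Type := {p : ℕ × ℕ // p.1 + 1 ≤ p.2 ∧ p.2 ≤ ℓ}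

namespace GroupTrellis

variable {S A : Type*} [Group S] [Group A] (T : GroupTrellis S A)

/-- The left state of a branch. -/
def left : T.branch →* S := (MonoidHom.fst S (A × S)).comp T.branch.subtype

/-- The right state of a branch. -/
def right : T.branch →* S :=
  ((MonoidHom.snd A S).comp (MonoidHom.snd S (A × S))).comp T.branch.subtype

/-- The group trellis: the group of all bi-infinite trellis paths. -/
def paths : Subgroup (ℤ → T.branch) where
  carrier := {c | ∀ t, T.right (c t) = T.left (c (t + 1))}
  mul_mem' := by
    intro a b ha hb t
    simp only [Pi.mul_apply, map_mul, ha t, hb t]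
  one_mem' := by
    intro t
    simp
  inv_mem' := by
    intro a ha t
    simp only [Pi.inv_apply, map_inv, ha t]

/-- The group of all trellis paths that are the identity outside the set of times `I`. -/
def pathsOn (I : Set ℤ) : Subgroup (ℤ → T.branch) where
  carrier := {c | c ∈ T.paths ∧ ∀ t ∉ I, c t = 1}
  mul_mem' := by
    rintro a b ⟨ha, ha'⟩ ⟨hb, hb'⟩
    refine ⟨mul_mem ha hb, fun t ht => ?_⟩
    simp [ha' t ht, hb' t ht]
  one_mem' := ⟨one_mem _, fun _ _ => rfl⟩
  inv_mem' := by
    rintro a ⟨ha, ha'⟩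
    refine ⟨inv_mem ha, fun t ht => ?_⟩
    simp [ha' t ht]

/-- `l`-controllability: any state at any time `t` is connected by a trellis path to any state
at time `t + l`. -/
def Controllable (l : ℕ) : Prop :=
  ∀ (t : ℤ) (s s' : S), ∃ c ∈ T.paths, T.left (c t) = s ∧ T.left (c (t + l)) = s'

/-- `X_j`: the time `j` branches of the paths that are the identity at all times `t < 0`. -/
def X (j : ℤ) : Subgroup T.branch :=
  (T.pathsOn (Set.Ici 0)).map (Pi.evalMonoidHom (fun _ : ℤ => T.branch) j)

/-- `Y_i`: the time `-i-1` branches of the paths that are the identity at all times `t ≥ 0`. -/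
def Y (i : ℤ) : Subgroup T.branch :=
  (T.pathsOn (Set.Iio 0)).map (Pi.evalMonoidHom (fun _ : ℤ => T.branch) (-i - 1))

/-- The next branch set of `H`: the branches `e` such that the left state of `e` is the right
state of some `b ∈ H`. -/
def next (H : Subgroup T.branch) : Subgroup T.branch := (H.map T.right).comap T.left

/-- `Δ_k = X_0 ∩ Y_k`. -/
def delta (k : ℤ) : Subgroup T.branch := T.X 0 ⊓ T.Y k

/-- `|Q_{j,k}|`, where `Q_{j,k} = N^j(Δ_k) / N^j(Δ_{k-1})` and `N` is the next branch map. -/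
noncomputable def cardQ (j k : ℕ) : ℕ :=
  (T.next^[j] (T.delta ((k : ℤ) - 1))).relIndex (T.next^[j] (T.delta k))

/-- The graph `D_U` of the shift register bank.  With `U_{j,k} = {0, …, |Q_{j,k}| - 1}`, an edge
is a triangular array `u` of integers `u_{j,k} ∈ U_{j,k}`, `0 ≤ j ≤ k ≤ ℓ`, and a node is such an
array without column `0`.  The edge `u` starts at the node formed by its columns `1, …, ℓ` and
ends at the node whose entry in position `(j + 1, k)` is `u_{j,k}`, for `j < k`. -/
def shiftGraph (ℓ : ℕ) :
    DirectedGraph (∀ p : TailIndex ℓ, Fin (T.cardQ (p.1.1 + 1) p.1.2))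
      (∀ p : TriIndex ℓ, Fin (T.cardQ p.1.1 p.1.2)) where
  endpoints u a b :=
    ∀ (j k : ℕ) (hj : j + 1 ≤ k) (hk : k ≤ ℓ),
      (a ⟨(j, k), hj, hk⟩ : ℕ) = (u ⟨(j + 1, k), hj, hk⟩ : ℕ) ∧
      (b ⟨(j, k), hj, hk⟩ : ℕ) = (u ⟨(j, k), Nat.le_of_succ_le hj, hk⟩ : ℕ)

/-- `G` is a set `[Γ_{[0,k]}]` of generators: a set of representatives of the cosets of
`C_{[0,k)} C_{(0,k]}` in `C_{[0,k]}`, in which the coset `C_{[0,k)} C_{(0,k]}` itself is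
represented by the identity path. -/
def IsGeneratorSet (k : ℕ) (G : Set (ℤ → T.branch)) : Prop :=
  G ⊆ T.pathsOn (Set.Icc 0 (k : ℤ)) ∧ 1 ∈ G ∧
    ∀ c ∈ T.pathsOn (Set.Icc 0 (k : ℤ)),
      ∃! g, g ∈ G ∧ c * g⁻¹ ∈ T.pathsOn (Set.Ico 0 (k : ℤ)) ⊔ T.pathsOn (Set.Ioc 0 (k : ℤ))

/-- The generator bases, given by their systems of coset representatives: the triangular arrays
`[r_{j,k}]`, `0 ≤ j ≤ k ≤ ℓ`, where for each `k` the set `[r_{j,k}]` consists of the time `j`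
components of the generators in a set of generators `[Γ_{[0,k]}]`. -/
def generatorBases (ℓ : ℕ) : Set (TriIndex ℓ → Set T.branch) :=
  {R | ∃ G : ℕ → Set (ℤ → T.branch), (∀ k ≤ ℓ, T.IsGeneratorSet k (G k)) ∧
    ∀ p : TriIndex ℓ, R p = (fun g => g (p.1.1 : ℤ)) '' G p.1.2}

/-- The vector basis formed from the system `[r_{j,k}]`: for each column `j` the set of all
representatives `x_j = r_{j,j} r_{j,j+1} ⋯ r_{j,ℓ}` of the cosets of `X_{j-1}` in `X_j`. -/
def vectorBasis {ℓ : ℕ} (R : TriIndex ℓ → Set T.branch) : Fin (ℓ + 1) → Set T.branch :=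
  fun j => {x | ∃ r : ℕ → T.branch,
    (∀ (k : ℕ) (hj : (j : ℕ) ≤ k) (hk : k ≤ ℓ), r k ∈ R ⟨(j, k), hj, hk⟩) ∧
    x = ((List.range' (j : ℕ) (ℓ + 1 - (j : ℕ))).map r).prod}

end GroupTrellis

/-! Write m_k = |Q_{0,k}| and N_k = C_{[0,k)} C_{(0,k]}. A generator basis is the image of a choice,
for each k ≤ ℓ, of a transversal of N_k in C_{[0,k]} that contains 1. Evaluation at time 0 and shift
invariance give [C_{[0,k]} : N_k] = m_k and |N_k| = ∏_{i<k} m_i^(k-i+1), so there are at most ∏_k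
|N_k|^(m_k-1) bases (`encard_generatorBases_le`). Collecting the powers of each m_i turns the second
bound into a numerical inequality, `prod_pow_sum_le_prod_factorial_pow`. The first bound follows
because its exponents are at least as large.

The order of the automorphism group is `ShiftRegister.card_aut`: an automorphism acts on an entry of
row k by a permutation of the alphabet that depends only on the entries of higher rows leaving the
register no earlier than it does, and every choice of such permutations occurs. Controllability
enters through `Controllable.cardQ_eq`: |Q_{j,k}| does not depend on j, so each row has a single
alphabet size. -/

/-! ### Numerical inequalities -/

theorem succ_mul_pred_add_one_le_pow {d : ℕ} (hd : 2 ≤ d) {n : ℕ} (hn : 1 ≤ n) :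
    (d + 1) * (n - 1) + 1 ≤ n ^ d := by
  obtain ⟨t, rfl⟩ := Nat.exists_eq_add_of_le' hn
  rw [Nat.add_sub_cancel]
  induction d, hd using Nat.le_induction with
  | base =>
    rcases t with _ | t
    · simp
    · nlinarith
  | succ d hd ih =>
    calc (d + 1 + 1) * t + 1 ≤ ((d + 1) * t + 1) * (t + 1) := by nlinarith [Nat.zero_le (d * t ^ 2)]
      _ ≤ (t + 1) ^ d * (t + 1) := Nat.mul_le_mul_right _ ih
      _ = (t + 1) ^ (d + 1) := (pow_succ _ _).symm

theorem Finset.one_add_sum_le_prod {ι : Type*} (s : Finset ι) (a b : ι → ℕ)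
    (h : ∀ i ∈ s, a i + 1 ≤ b i) : (∑ i ∈ s, a i) + 1 ≤ ∏ i ∈ s, b i := by
  classical
  induction s using Finset.induction_on with
  | empty => simp
  | insert i s hi ih =>
    rw [Finset.sum_insert hi, Finset.prod_insert hi]
    have h1 := ih fun j hj => h j (Finset.mem_insert_of_mem hj)
    have h2 := h i (Finset.mem_insert_self i s)
    calc a i + ∑ j ∈ s, a j + 1 ≤ (a i + 1) * (∑ j ∈ s, a j + 1) := by
          nlinarith [Nat.zero_le (a i * ∑ j ∈ s, a j)]
      _ ≤ _ := Nat.mul_le_mul h2 h1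

/-- For k = i + 1 the termwise comparison can fail: with t = m_{i+1} - 1 it is 2t against t + 1. The
product over k ≥ i + 2 is at least 2, because it contains a power of m_ℓ, and absorbs the loss. -/
theorem sum_exponents_le_prod (m : ℕ → ℕ) (hm : ∀ k, 1 ≤ m k) {i ℓ : ℕ} (hi : i + 2 ≤ ℓ)
    (hℓ : 2 ≤ m ℓ) :
    ∑ k ∈ Finset.Ioc i ℓ, (k - i + 1) * (m k - 1) ≤ ∏ k ∈ Finset.Ioc i ℓ, m k ^ (k - i) := by
  have hI : Finset.Ioc i ℓ = insert (i + 1) (Finset.Ioc (i + 1) ℓ) := by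
    ext k; simp only [Finset.mem_Ioc, Finset.mem_insert]; omega
  have hn : i + 1 ∉ Finset.Ioc (i + 1) ℓ := by simp
  rw [hI, Finset.sum_insert hn, Finset.prod_insert hn]
  have h1 := Finset.one_add_sum_le_prod (Finset.Ioc (i + 1) ℓ)
    (fun k => (k - i + 1) * (m k - 1)) (fun k => m k ^ (k - i)) (fun k hk => by
      rw [Finset.mem_Ioc] at hk
      exact succ_mul_pred_add_one_le_pow (by omega) (hm k))
  have h2 : 2 ≤ ∏ k ∈ Finset.Ioc (i + 1) ℓ, m k ^ (k - i) := by
    calc 2 ≤ m ℓ := hℓ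
      _ ≤ m ℓ ^ (ℓ - i) := Nat.le_self_pow (by omega) _
      _ ≤ _ := Finset.single_le_prod' (f := fun k => m k ^ (k - i))
          (fun k _ => Nat.one_le_pow _ _ (hm k)) (by simp; omega)
  obtain ⟨t, ht⟩ := Nat.exists_eq_add_of_le' (hm (i + 1))
  simp only [Nat.add_sub_cancel_left, ht, Nat.add_sub_cancel, pow_one]
  nlinarith

theorem sq_le_two_mul_factorial (a : ℕ) : a ^ 2 ≤ 2 * a.factorial := by
  rcases Nat.lt_or_ge a 4 with h | h
  · interval_cases a <;> decide
  · induction a, h using Nat.le_induction with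
    | base => decide
    | succ n hn ih =>
      rw [Nat.factorial_succ]
      nlinarith

theorem two_pow_pred_le_factorial (n : ℕ) : 2 ^ (n - 1) ≤ n.factorial := by
  rcases n with _ | n
  · simp
  · induction n with
    | zero => simp
    | succ n ih =>
      rw [Nat.factorial_succ, Nat.add_sub_cancel, pow_succ, mul_comm]
      exact Nat.mul_le_mul (by omega) (by simpa using ih)

/-- Treats the last two rows together: the exponent 2(n - 1) may exceed n, and the factorial of the
last row compensates. -/
theorem pow_two_mul_pred_le (a n : ℕ) :
    a ^ (2 * (n - 1)) ≤ a.factorial ^ n * n.factorial := by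
  calc a ^ (2 * (n - 1)) = (a ^ 2) ^ (n - 1) := pow_mul _ _ _
    _ ≤ (2 * a.factorial) ^ (n - 1) := Nat.pow_le_pow_left (sq_le_two_mul_factorial a) _
    _ = a.factorial ^ (n - 1) * 2 ^ (n - 1) := by rw [mul_pow, mul_comm]
    _ ≤ _ := Nat.mul_le_mul
      (Nat.pow_le_pow_right (Nat.factorial_pos a) (Nat.sub_le _ _)) (two_pow_pred_le_factorial n)

theorem prod_pow_sum_le_prod_factorial_pow (m : ℕ → ℕ) (hm : ∀ k, 1 ≤ m k) (ℓ : ℕ) :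
    ∏ i ∈ Finset.range (ℓ + 1), m i ^ (∑ k ∈ Finset.Ioc i ℓ, (k - i + 1) * (m k - 1)) ≤
      ∏ i ∈ Finset.range (ℓ + 1),
        (m i).factorial ^ (∏ k ∈ Finset.Ioc i ℓ, m k ^ (k - i)) := by
  induction ℓ with
  | zero => simpa using Nat.one_le_iff_ne_zero.2 (Nat.factorial_ne_zero (m 0))
  | succ ℓ ih =>
    -- A last row with a one-letter alphabet contributes nothing and is dropped by induction.
    -- Otherwise the rows below the last two are compared one by one.
    rcases (hm (ℓ + 1)).eq_or_lt with h | h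
    · have hI : ∀ i ∈ Finset.range (ℓ + 1),
          Finset.Ioc i (ℓ + 1) = insert (ℓ + 1) (Finset.Ioc i ℓ) := by
        intro i hi
        rw [Finset.mem_range] at hi
        ext k; simp only [Finset.mem_Ioc, Finset.mem_insert]; omega
      have hn : ∀ i, ℓ + 1 ∉ Finset.Ioc i ℓ := by simp
      rw [Finset.prod_range_succ _ (ℓ + 1), Finset.prod_range_succ _ (ℓ + 1)]
      refine Nat.mul_le_mul ?_ (by simp [← h])
      calc _ = _ := Finset.prod_congr rfl fun i hi => by
            rw [hI i hi, Finset.sum_insert (hn i), ← h, Nat.sub_self, mul_zero, zero_add]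
        _ ≤ _ := ih
        _ = _ := Finset.prod_congr rfl fun i hi => by
            rw [hI i hi, Finset.prod_insert (hn i), ← h, one_pow, one_mul]
    · rw [Finset.prod_range_succ _ (ℓ + 1), Finset.prod_range_succ _ (ℓ + 1),
        Finset.prod_range_succ _ ℓ, Finset.prod_range_succ _ ℓ, mul_assoc, mul_assoc]
      have hI : Finset.Ioc ℓ (ℓ + 1) = {ℓ + 1} := by
        ext k; simp only [Finset.mem_Ioc, Finset.mem_singleton]; omega
      refine Nat.mul_le_mul (Finset.prod_le_prod' fun i hi => ?_) ?_
      · rw [Finset.mem_range] at hi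
        calc _ ≤ (m i).factorial ^ (∑ k ∈ Finset.Ioc i (ℓ + 1), (k - i + 1) * (m k - 1)) :=
              Nat.pow_le_pow_left (Nat.self_le_factorial _) _
          _ ≤ _ := Nat.pow_le_pow_right (Nat.factorial_pos _)
              (sum_exponents_le_prod m hm (by omega) h)
      · simpa [hI] using pow_two_mul_pred_le (m ℓ) (m (ℓ + 1))

theorem prod_prod_pow_eq_prod_pow_sum (m : ℕ → ℕ) (ℓ : ℕ) :
    ∏ k ∈ Finset.range (ℓ + 1), (∏ i ∈ Finset.range k, m i ^ (k - i + 1)) ^ (m k - 1) =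
      ∏ i ∈ Finset.range (ℓ + 1),
        m i ^ (∑ k ∈ Finset.Ioc i ℓ, (k - i + 1) * (m k - 1)) := by
  simp only [← Finset.prod_pow, ← Finset.prod_pow_eq_pow_sum, ← pow_mul]
  refine Finset.prod_comm' fun k i => ?_
  simp only [Finset.mem_range, Finset.mem_Ioc]
  omega

/-! ### Counting transversals -/

/-- Right transversals of a finite subgroup `N` in `C` that represent the trivial coset by `1`:
there are at most `|N| ^ ([C : N] - 1)` of them. -/
theorem card_transversals_le {Γ : Type*} [Group Γ] (N C : Subgroup Γ) [Finite C] (hNC : N ≤ C) :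
    Finite {G : Set Γ // G ⊆ C ∧ 1 ∈ G ∧ ∀ c ∈ C, ∃! g, g ∈ G ∧ c * g⁻¹ ∈ N} ∧
    Nat.card {G : Set Γ // G ⊆ C ∧ 1 ∈ G ∧ ∀ c ∈ C, ∃! g, g ∈ G ∧ c * g⁻¹ ∈ N} ≤
      Nat.card N ^ (N.relIndex C - 1) := by
  classical
  have : Finite N := Finite.of_injective _ (Subgroup.inclusion_injective hNC)
  let Q := C ⧸ N.subgroupOf C
  -- `Q` consists of left cosets, whereas `c * g⁻¹ ∈ N` concerns right cosets; inversion exchanges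
  -- them.
  have hout : ∀ q : Q, ((q.out : C) : Γ)⁻¹ ∈ C := fun q => inv_mem q.out.2
  choose g hg hgu using fun (G : {G : Set Γ // G ⊆ C ∧ 1 ∈ G ∧
    ∀ c ∈ C, ∃! g, g ∈ G ∧ c * g⁻¹ ∈ N}) (q : Q) => G.2.2.2 _ (hout q)
  -- The trivial coset is left out, since its representative is forced to be 1; this gives the `- 1`
  -- in the exponent.
  let F : {G : Set Γ // G ⊆ C ∧ 1 ∈ G ∧ ∀ c ∈ C, ∃! g, g ∈ G ∧ c * g⁻¹ ∈ N} →
      ({q : Q // q ≠ ((1 : C) : Q)} → N) := fun G q => ⟨_, (hg G q.1).2⟩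
  have hmem : ∀ G, ∀ x ∈ G.1, ∃ q, g G q = x := by
    intro G x hx
    refine ⟨((⟨x, G.2.1 hx⟩⁻¹ : C) : Q), (hgu G _ x ⟨hx, ?_⟩).symm⟩
    have := QuotientGroup.mk_out_eq_mul (N.subgroupOf C) (⟨x, G.2.1 hx⟩⁻¹ : C)
    obtain ⟨n, hn⟩ := this
    rw [hn]
    have h := inv_mem (Subgroup.mem_subgroupOf.1 n.2)
    simpa using h
  have h1 : ∀ G, g G ((1 : C) : Q) = 1 := by
    intro G
    refine (hgu G _ 1 ⟨G.2.2.1, ?_⟩).symm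
    obtain ⟨n, hn⟩ := QuotientGroup.mk_out_eq_mul (N.subgroupOf C) (1 : C)
    rw [hn]
    simpa using inv_mem (Subgroup.mem_subgroupOf.1 n.2)
  have hF : Function.Injective F := by
    intro G G' h
    have hq : ∀ q, g G q = g G' q := by
      intro q
      by_cases hq : q = ((1 : C) : Q)
      · rw [hq, h1, h1]
      · have := congrArg Subtype.val (congrFun h ⟨q, hq⟩)
        simpa [F] using this
    apply Subtype.ext
    ext x
    constructor
    · intro hx
      obtain ⟨q, rfl⟩ := hmem G x hx
      rw [hq]; exact (hg G' q).1
    · intro hx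
      obtain ⟨q, rfl⟩ := hmem G' x hx
      rw [← hq]; exact (hg G q).1
  have hfin : Finite Q := inferInstance
  refine ⟨Finite.of_injective F hF, (Nat.card_le_card_of_injective F hF).trans_eq ?_⟩
  have : Fintype Q := Fintype.ofFinite Q
  rw [Nat.card_fun, Nat.card_eq_fintype_card (α := {q : Q // q ≠ ((1 : C) : Q)}),
    Fintype.card_subtype_compl, Fintype.card_subtype_eq, ← Nat.card_eq_fintype_card]
  rfl

/-- The shift register bank in which row `k` has alphabet `Fin (m k)`, with an arbitrary
alphabet for every single position of an edge and of a node. -/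
def registerGraph {ℓ : ℕ} (f : TriIndex ℓ → ℕ) (g : TailIndex ℓ → ℕ) :
    DirectedGraph (∀ p, Fin (g p)) (∀ p, Fin (f p)) where
  endpoints u a b :=
    ∀ (j k : ℕ) (hj : j + 1 ≤ k) (hk : k ≤ ℓ),
      (a ⟨(j, k), hj, hk⟩ : ℕ) = (u ⟨(j + 1, k), hj, hk⟩ : ℕ) ∧
      (b ⟨(j, k), hj, hk⟩ : ℕ) = (u ⟨(j, k), Nat.le_of_succ_le hj, hk⟩ : ℕ)

/-! ### Automorphisms of the shift register graph built from permutations -/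

namespace ShiftRegister

variable {ℓ : ℕ} {m : ℕ → ℕ}

/-- Edges: triangular arrays whose row `k` has entries in `Fin (m k)`. -/
abbrev Edge (ℓ : ℕ) (m : ℕ → ℕ) : Type := ∀ p : TriIndex ℓ, Fin (m p.1.2)

/-- Nodes: triangular arrays without column `0`. -/
abbrev Node (ℓ : ℕ) (m : ℕ → ℕ) : Type := ∀ p : TailIndex ℓ, Fin (m p.1.2)

instance : Finite (TriIndex ℓ) :=
  Finite.of_injective (β := Fin (ℓ + 1) × Fin (ℓ + 1))
    (fun q => (⟨q.1.1, by have := q.2; omega⟩, ⟨q.1.2, by have := q.2; omega⟩)) fun a b h => by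
      simp only [Prod.mk.injEq, Fin.mk.injEq] at h
      exact Subtype.ext (Prod.ext h.1 h.2)

instance : Finite (TailIndex ℓ) :=
  Finite.of_injective (β := TriIndex ℓ) (fun q => ⟨q.1, by have := q.2; omega⟩) fun a b h =>
    Subtype.ext (congrArg (fun p : TriIndex ℓ => p.1) h)

theorem edge_congr (u : Edge ℓ m) {i j k : ℕ} (h : i = j) (hi : i ≤ k ∧ k ≤ ℓ)
    (hj : j ≤ k ∧ k ≤ ℓ) : u ⟨(i, k), hi⟩ = u ⟨(j, k), hj⟩ := by
  subst h; rfl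

/-- The start node of an edge. -/
def src (u : Edge ℓ m) : Node ℓ m := fun p => u ⟨(p.1.1 + 1, p.1.2), p.2.1, p.2.2⟩

/-- The end node of an edge. -/
def tgt (u : Edge ℓ m) : Node ℓ m := fun p => u ⟨(p.1.1, p.1.2), Nat.le_of_succ_le p.2.1, p.2.2⟩

/-- The graph of the shift register bank with alphabet `Fin (m k)` in row `k`. -/
abbrev graph (ℓ : ℕ) (m : ℕ → ℕ) : DirectedGraph (Node ℓ m) (Edge ℓ m) :=
  registerGraph (fun p : TriIndex ℓ => m p.1.2) (fun p : TailIndex ℓ => m p.1.2)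

theorem endpoints_iff (u : Edge ℓ m) (a b : Node ℓ m) :
    (graph ℓ m).endpoints u a b ↔ a = src u ∧ b = tgt u := by
  constructor
  · intro h
    exact ⟨funext fun p => Fin.ext (h p.1.1 p.1.2 p.2.1 p.2.2).1,
      funext fun p => Fin.ext (h p.1.1 p.1.2 p.2.1 p.2.2).2⟩
  · rintro ⟨rfl, rfl⟩ j k hj hk
    exact ⟨rfl, rfl⟩

theorem mem_aut_iff (φ : Equiv.Perm (Node ℓ m) × Equiv.Perm (Edge ℓ m)) :
    φ ∈ (graph ℓ m).Aut ↔ ∀ u, φ.1 (src u) = src (φ.2 u) ∧ φ.1 (tgt u) = tgt (φ.2 u) := by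
  constructor
  · intro h u
    exact (endpoints_iff _ _ _).1 (h u _ _ ((endpoints_iff _ _ _).2 ⟨rfl, rfl⟩))
  · intro h u a b hu
    obtain ⟨rfl, rfl⟩ := (endpoints_iff _ _ _).1 hu
    exact (endpoints_iff _ _ _).2 (h u)

theorem inv_mem_aut {φ : Equiv.Perm (Node ℓ m) × Equiv.Perm (Edge ℓ m)}
    (h : φ ∈ (graph ℓ m).Aut) : φ⁻¹ ∈ (graph ℓ m).Aut := by
  rw [mem_aut_iff] at h ⊢
  intro u
  obtain ⟨v, rfl⟩ := φ.2.surjective u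
  simp [← (h v).1, ← (h v).2]

/-- The positions, relative to a position in row `k`, of the entries of higher rows that stay in
the array as long as the entry in row `k` does. -/
abbrev WindowIndex (ℓ k : ℕ) : Type := {q : ℕ × ℕ // k < q.2 ∧ q.2 ≤ ℓ ∧ q.1 + k ≤ q.2}

instance (k : ℕ) : Finite (WindowIndex ℓ k) :=
  Finite.of_injective (β := TriIndex ℓ) (fun q => ⟨q.1, by have := q.2; omega⟩) fun a b h =>
    Subtype.ext (congrArg (fun p : TriIndex ℓ => p.1) h)

/-- The contents of a window. -/
abbrev Window (ℓ : ℕ) (m : ℕ → ℕ) (k : ℕ) : Type := ∀ q : WindowIndex ℓ k, Fin (m q.1.2)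

/-- The window of the edge `u` at the position `(j, k)`. -/
def window (u : Edge ℓ m) (j k : ℕ) (h : j ≤ k) : Window ℓ m k :=
  fun q => u ⟨(j + q.1.1, q.1.2), by have := q.2; dsimp only; omega⟩

/-- The window of the node `v` at the position `(j + 1, k)`. -/
def nodeWindow (v : Node ℓ m) (j k : ℕ) (h : j + 1 ≤ k) : Window ℓ m k :=
  fun q => v ⟨(j + q.1.1, q.1.2), by have := q.2; dsimp only; omega⟩

/-- A choice of a permutation of the alphabet of every row for every content of the window. -/
abbrev Family (ℓ : ℕ) (m : ℕ → ℕ) : Type :=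
  ∀ k : Fin (ℓ + 1), Window ℓ m k → Equiv.Perm (Fin (m k))

/-- The map of edges defined by a family of permutations. -/
def edgeMap (π : Family ℓ m) (u : Edge ℓ m) : Edge ℓ m := fun p =>
  π ⟨p.1.2, Nat.lt_succ_of_le p.2.2⟩ (window u p.1.1 p.1.2 p.2.1) (u p)

/-- The map of nodes defined by a family of permutations. -/
def nodeMap (π : Family ℓ m) (v : Node ℓ m) : Node ℓ m := fun p =>
  π ⟨p.1.2, Nat.lt_succ_of_le p.2.2⟩ (nodeWindow v p.1.1 p.1.2 p.2.1) (v p)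

/-- The map is triangular: windows lie in strictly higher rows, so entries are recovered from the
top row downwards. -/
theorem edgeMap_injective (π : Family ℓ m) : Function.Injective (edgeMap π) := by
  intro u v h
  suffices H : ∀ n j k (hj : j ≤ k) (hk : k ≤ ℓ), ℓ - k ≤ n →
      u ⟨(j, k), hj, hk⟩ = v ⟨(j, k), hj, hk⟩ from
    funext fun p => H ℓ p.1.1 p.1.2 p.2.1 p.2.2 (Nat.sub_le _ _)
  intro n
  induction n using Nat.strong_induction_on with
  | _ n ih =>
    intro j k hj hk hn
    have hw : window u j k hj = window v j k hj := by
      funext q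
      have := q.2
      exact ih (ℓ - q.1.2) (by omega) _ _ (by omega) (by omega) le_rfl
    have := congrFun h ⟨(j, k), hj, hk⟩
    simp only [edgeMap, hw] at this
    exact (Equiv.injective _) this

theorem nodeMap_injective (π : Family ℓ m) : Function.Injective (nodeMap π) := by
  intro u v h
  suffices H : ∀ n j k (hj : j + 1 ≤ k) (hk : k ≤ ℓ), ℓ - k ≤ n →
      u ⟨(j, k), hj, hk⟩ = v ⟨(j, k), hj, hk⟩ from
    funext fun p => H ℓ p.1.1 p.1.2 p.2.1 p.2.2 (Nat.sub_le _ _)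
  intro n
  induction n using Nat.strong_induction_on with
  | _ n ih =>
    intro j k hj hk hn
    have hw : nodeWindow u j k hj = nodeWindow v j k hj := by
      funext q
      have := q.2
      exact ih (ℓ - q.1.2) (by omega) _ _ (by omega) (by omega) le_rfl
    have := congrFun h ⟨(j, k), hj, hk⟩
    simp only [nodeMap, hw] at this
    exact (Equiv.injective _) this

theorem nodeMap_src (π : Family ℓ m) (u : Edge ℓ m) : nodeMap π (src u) = src (edgeMap π u) := by
  funext p
  have : nodeWindow (src u) p.1.1 p.1.2 p.2.1 = window u (p.1.1 + 1) p.1.2 p.2.1 := by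
    funext q
    exact edge_congr u (Nat.add_right_comm _ _ _) _ _
  simp only [nodeMap, this]
  rfl

theorem nodeMap_tgt (π : Family ℓ m) (u : Edge ℓ m) : nodeMap π (tgt u) = tgt (edgeMap π u) := rfl

/-- The automorphism defined by a family of permutations. -/
noncomputable def autOfFamily (π : Family ℓ m) : (graph ℓ m).Aut :=
  ⟨(Equiv.ofBijective _ (Finite.injective_iff_bijective.1 (nodeMap_injective π)),
    Equiv.ofBijective _ (Finite.injective_iff_bijective.1 (edgeMap_injective π))),
    (mem_aut_iff _).2 fun u => ⟨nodeMap_src π u, nodeMap_tgt π u⟩⟩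

theorem autOfFamily_snd (π : Family ℓ m) (u : Edge ℓ m) :
    (autOfFamily π).1.2 u = edgeMap π u := rfl

theorem exists_edge (hm : ∀ k, 1 ≤ m k) {k : ℕ} (hk : k ≤ ℓ) (w : Window ℓ m k)
    (a : Fin (m k)) : ∃ u : Edge ℓ m, window u 0 k (Nat.zero_le k) = w ∧
      u ⟨(0, k), Nat.zero_le k, hk⟩ = a := by
  classical
  refine ⟨Function.update (fun p => if h : k < p.1.2 ∧ p.1.2 ≤ ℓ ∧ p.1.1 + k ≤ p.1.2
    then w ⟨p.1, h⟩ else ⟨0, hm _⟩) ⟨(0, k), Nat.zero_le k, hk⟩ a, ?_, Function.update_self ..⟩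
  funext ⟨⟨i, k'⟩, h⟩
  have hne : (⟨(0 + i, k'), by dsimp only at h ⊢; omega⟩ : TriIndex ℓ) ≠
      ⟨(0, k), Nat.zero_le k, hk⟩ := by
    intro he
    have := congrArg (fun p : TriIndex ℓ => p.1.2) he
    dsimp only at this h
    omega
  rw [window]
  dsimp only
  rw [Function.update_of_ne hne]
  dsimp only
  rw [dif_pos (by simpa using h)]
  congr 1
  simp

theorem autOfFamily_injective (hm : ∀ k, 1 ≤ m k) :
    Function.Injective (autOfFamily : Family ℓ m → (graph ℓ m).Aut) := by
  intro π π' h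
  funext k w
  ext a : 1
  obtain ⟨u, rfl, rfl⟩ := exists_edge hm (Nat.le_of_lt_succ k.2) w a
  have h2 : edgeMap π u = edgeMap π' u := by
    rw [← autOfFamily_snd, h, autOfFamily_snd]
  exact congrFun h2 ⟨(0, (k : ℕ)), Nat.zero_le _, Nat.le_of_lt_succ k.2⟩

/-! ### Every automorphism comes from a family of permutations -/

variable {φ : Equiv.Perm (Node ℓ m) × Equiv.Perm (Edge ℓ m)}

/-- The hypothesis says that a path of n steps leads from `e` to `f`. Automorphisms preserve paths,
so the images overlap in the same way. -/
theorem aut_apply_of_path (hφ : φ ∈ (graph ℓ m).Aut) (n : ℕ) (e f : Edge ℓ m)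
    (hef : ∀ i k (h : i + n ≤ k) (hk : k ≤ ℓ),
      f ⟨(i + n, k), h, hk⟩ = e ⟨(i, k), by omega, hk⟩)
    (j k : ℕ) (h : j + n ≤ k) (hk : k ≤ ℓ) :
    φ.2 f ⟨(j + n, k), h, hk⟩ = φ.2 e ⟨(j, k), by omega, hk⟩ := by
  induction n generalizing e j with
  | zero =>
    have : f = e := funext fun p => hef p.1.1 p.1.2 p.2.1 p.2.2
    subst this; rfl
  | succ n ih =>
    -- The first edge after `e`: column 0 receives what must stand in column n of `f` after n more
    -- steps. Rows with k < n have no column n, so their new entry is arbitrary.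
    let g : Edge ℓ m := fun p =>
      match p with
      | ⟨(0, k), hp⟩ => if h : n ≤ k then f ⟨(n, k), h, hp.2⟩ else e ⟨(0, k), hp⟩
      | ⟨(i + 1, k), hp⟩ => e ⟨(i, k), Nat.le_of_succ_le hp.1, hp.2⟩
    have hg : src g = tgt e := rfl
    have h1 := ih g (fun i k h hk => by
      rcases i with _ | i
      · have : n ≤ k := by omega
        simp only [g, this, dif_pos]
        exact edge_congr f (Nat.zero_add n) _ _
      · have := hef i k (by omega) hk
        simp only [g, ← this]
        exact edge_congr f (by omega) _ _) (j + 1) (by omega)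
    have h2 : src (φ.2 g) = tgt (φ.2 e) := by
      rw [← ((mem_aut_iff _).1 hφ g).1, hg, ((mem_aut_iff _).1 hφ e).2]
    have h3 := congrFun h2 ⟨(j, k), by dsimp only; omega⟩
    simp only [src, tgt] at h3
    rw [← h3, ← h1]
    exact edge_congr _ (by omega) _ _

/-- The image at a position depends only on its entry and its window. Both edges lead to a common
edge `f`, `u` in k - j steps and `v` in k steps, and both positions arrive at (k, k), the last place
of row k. -/
theorem aut_apply_eq_of_shift (hφ : φ ∈ (graph ℓ m).Aut) (u v : Edge ℓ m) {j k : ℕ} (hj : j ≤ k)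
    (hk : k ≤ ℓ)
    (huv : ∀ i k' (_ : k ≤ k') (hi : i + k ≤ k') (hk' : k' ≤ ℓ),
      u ⟨(j + i, k'), by omega, hk'⟩ = v ⟨(i, k'), by omega, hk'⟩) :
    φ.2 u ⟨(j, k), hj, hk⟩ = φ.2 v ⟨(0, k), Nat.zero_le k, hk⟩ := by
  let f : Edge ℓ m := fun p =>
    if k ≤ p.1.1 then v ⟨(p.1.1 - k, p.1.2), by have := p.2; dsimp only; omega⟩
    else u ⟨(p.1.1 - (k - j), p.1.2), by have := p.2; dsimp only; omega⟩
  have h1 := aut_apply_of_path hφ (k - j) u f (fun i k' h hk' => by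
    simp only [f]
    split_ifs with hc
    · rw [← huv _ _ (by omega) (by omega) hk']
      exact edge_congr u (by omega) _ _
    · exact edge_congr u (by omega) _ _) j k (by omega) hk
  have h2 := aut_apply_of_path hφ k v f (fun i k' h hk' => by
    simp only [f, Nat.le_add_left, if_true]
    exact edge_congr v (by omega) _ _) 0 k (by omega) hk
  rw [← h1, ← h2]
  exact edge_congr _ (by omega) _ _

theorem aut_apply_congr (hφ : φ ∈ (graph ℓ m).Aut) (u v : Edge ℓ m) {j k : ℕ} (hj : j ≤ k)
    (hk : k ≤ ℓ)
    (huv : ∀ i k' (_ : k ≤ k') (hi : i ≤ k') (hk' : k' ≤ ℓ),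
      u ⟨(i, k'), hi, hk'⟩ = v ⟨(i, k'), hi, hk'⟩) :
    φ.2 u ⟨(j, k), hj, hk⟩ = φ.2 v ⟨(j, k), hj, hk⟩ := by
  -- `u` moved j columns back; in rows ≥ k it is equally `v` moved back.
  let w : Edge ℓ m := fun p =>
    if h : j + p.1.1 ≤ p.1.2 then u ⟨(j + p.1.1, p.1.2), h, p.2.2⟩ else u p
  rw [aut_apply_eq_of_shift hφ u w hj hk, aut_apply_eq_of_shift hφ v w hj hk]
  · intro i k' h hi hk'
    have : j + i ≤ k' := by omega
    rw [← huv _ _ h this hk']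
    simp [w, this]
  · intro i k' h hi hk'
    have : j + i ≤ k' := by omega
    simp [w, this]

/-- Locality is applied to the inverse automorphism. It requires the images to agree on the window,
which is arranged by replacing `v` with `v'`, a copy of `u` changed only at (0, k). -/
theorem aut_apply_injective (hφ : φ ∈ (graph ℓ m).Aut) (u v : Edge ℓ m) {k : ℕ} (hk : k ≤ ℓ)
    (huv : ∀ i k' (_ : k < k') (hi : i + k ≤ k') (hk' : k' ≤ ℓ),
      u ⟨(i, k'), by omega, hk'⟩ = v ⟨(i, k'), by omega, hk'⟩)
    (h : φ.2 u ⟨(0, k), Nat.zero_le k, hk⟩ = φ.2 v ⟨(0, k), Nat.zero_le k, hk⟩) :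
    u ⟨(0, k), Nat.zero_le k, hk⟩ = v ⟨(0, k), Nat.zero_le k, hk⟩ := by
  classical
  let v' : Edge ℓ m := Function.update u ⟨(0, k), Nat.zero_le k, hk⟩
    (v ⟨(0, k), Nat.zero_le k, hk⟩)
  have hne : ∀ i k' (hi : i ≤ k') (hk' : k' ≤ ℓ), k < k' →
      v' ⟨(i, k'), hi, hk'⟩ = u ⟨(i, k'), hi, hk'⟩ := by
    intro i k' hi hk' hlt
    refine Function.update_of_ne ?_ _ _
    intro he
    have := congrArg (fun p : TriIndex ℓ => p.1.2) he
    dsimp only at this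
    omega
  have hself : v' ⟨(0, k), Nat.zero_le k, hk⟩ = v ⟨(0, k), Nat.zero_le k, hk⟩ :=
    Function.update_self ..
  have hv : φ.2 v' ⟨(0, k), Nat.zero_le k, hk⟩ = φ.2 v ⟨(0, k), Nat.zero_le k, hk⟩ := by
    refine aut_apply_eq_of_shift hφ v' v (Nat.zero_le k) hk ?_
    intro i k' h hi hk'
    refine (edge_congr v' (Nat.zero_add i) _ ⟨by omega, hk'⟩).trans ?_
    rcases h.eq_or_lt with rfl | h
    · obtain rfl : i = 0 := by omega
      exact hself
    · rw [hne _ _ (by omega) hk' h, huv _ _ h hi hk']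
  have key := aut_apply_eq_of_shift (inv_mem_aut hφ) (φ.2 u) (φ.2 v') (Nat.zero_le k) hk (by
    intro i k' h' hi hk'
    refine (edge_congr _ (Nat.zero_add i) _ ⟨by omega, hk'⟩).trans ?_
    rcases h'.eq_or_lt with rfl | h'
    · obtain rfl : i = 0 := by omega
      rw [h, hv]
    · refine aut_apply_congr hφ u v' (by omega) hk' ?_
      intro i k'' h hi hk''
      exact (hne _ _ hi hk'' (by omega)).symm)
  simpa [hself] using key

theorem autOfFamily_surjective (hm : ∀ k, 1 ≤ m k) :
    Function.Surjective (autOfFamily : Family ℓ m → (graph ℓ m).Aut) := by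
  rintro ⟨φ, hφ⟩
  choose e he1 he2 using fun (k : Fin (ℓ + 1)) (w : Window ℓ m k) (a : Fin (m k)) =>
    exists_edge hm (Nat.le_of_lt_succ k.2) w a
  have hinj : ∀ (k : Fin (ℓ + 1)) (w : Window ℓ m k), Function.Injective fun a =>
      φ.2 (e k w a) ⟨(0, (k : ℕ)), Nat.zero_le _, Nat.le_of_lt_succ k.2⟩ := by
    intro k w a b hab
    rw [← he2 k w a, ← he2 k w b]
    refine aut_apply_injective hφ _ _ (Nat.le_of_lt_succ k.2) ?_ hab
    intro i k' h hi hk'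
    have := congrFun ((he1 k w a).trans (he1 k w b).symm) ⟨(i, k'), h, hk', hi⟩
    exact (edge_congr _ (Nat.zero_add i).symm _ _).trans
      (this.trans (edge_congr _ (Nat.zero_add i) _ _))
  let π : Family ℓ m := fun k w =>
    Equiv.ofBijective _ (Finite.injective_iff_bijective.1 (hinj k w))
  have hedge : ∀ u, edgeMap π u = φ.2 u := by
    intro u
    funext ⟨⟨j, k⟩, hj, hk⟩
    symm
    refine aut_apply_eq_of_shift hφ u _ hj hk ?_
    intro i k' h hi hk'
    let k₀ : Fin (ℓ + 1) := ⟨k, Nat.lt_succ_of_le hk⟩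
    rcases h.eq_or_lt with rfl | h
    · obtain rfl : i = 0 := by omega
      exact (he2 k₀ (window u j k hj) (u ⟨(j, k), hj, hk⟩)).symm
    · have := congrFun (he1 k₀ (window u j k hj) (u ⟨(j, k), hj, hk⟩)) ⟨(i, k'), h, hk', hi⟩
      exact this.symm.trans (edge_congr _ (Nat.zero_add i) _ _)
  refine ⟨π, Subtype.ext (Prod.ext ?_ ?_)⟩
  · ext v : 1
    -- Every node is the end of some edge, so the edge permutation determines the node permutation.
    let u : Edge ℓ m := fun p =>
      if h : p.1.1 + 1 ≤ p.1.2 then v ⟨p.1, h, p.2.2⟩ else ⟨0, hm _⟩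
    have hu : tgt u = v := by
      funext p
      exact dif_pos p.2.1
    rw [← hu, ((mem_aut_iff _).1 hφ u).2, ← hedge]
    exact nodeMap_tgt π u
  · ext u : 1
    exact hedge u

/-- Row k' contributes the k' - k + 1 columns 0, …, k' - k. -/
theorem card_window (k : ℕ) :
    Nat.card (Window ℓ m k) = ∏ k' ∈ Finset.Ioc k ℓ, m k' ^ (k' - k + 1) := by
  classical
  let e : WindowIndex ℓ k ≃ (Σ k' : Finset.Ioc k ℓ, Fin ((k' : ℕ) - k + 1)) :=
    { toFun := fun q => ⟨⟨q.1.2, Finset.mem_Ioc.2 ⟨q.2.1, q.2.2.1⟩⟩,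
        ⟨q.1.1, by have := q.2; dsimp only; omega⟩⟩
      invFun := fun q => ⟨(q.2, q.1), by
        have h1 := Finset.mem_Ioc.1 q.1.2
        have h2 := q.2.2
        dsimp only
        omega⟩
      left_inv := fun q => rfl
      right_inv := fun q => rfl }
  rw [Nat.card_congr (Equiv.piCongrLeft' (fun q : WindowIndex ℓ k => Fin (m q.1.2)) e),
    Nat.card_pi, Fintype.prod_sigma,
    ← Finset.prod_coe_sort _ fun k' => m k' ^ (k' - k + 1)]
  refine Finset.prod_congr rfl fun k' _ => ?_
  simp [e]

theorem card_aut (hm : ∀ k, 1 ≤ m k) :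
    Nat.card (graph ℓ m).Aut = ∏ k ∈ Finset.range (ℓ + 1),
      (m k).factorial ^ (∏ k' ∈ Finset.Ioc k ℓ, m k' ^ (k' - k + 1)) := by
  rw [← Nat.card_congr (Equiv.ofBijective _
    ⟨autOfFamily_injective (ℓ := ℓ) hm, autOfFamily_surjective hm⟩), Nat.card_pi,
    ← Fin.prod_univ_eq_prod_range
      (fun k => (m k).factorial ^ (∏ k' ∈ Finset.Ioc k ℓ, m k' ^ (k' - k + 1)))]
  refine Finset.prod_congr rfl fun k _ => ?_
  rw [Nat.card_fun, card_window, Nat.card_perm, Nat.card_fin]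

end ShiftRegister

/-! ### Paths of the trellis and independence of |Q_{j,k}| from j -/

namespace GroupTrellis

variable {S A : Type*} [Group S] [Group A] (T : GroupTrellis S A)

theorem left_surjective : Function.Surjective T.left := fun s =>
  let ⟨b, hb, h⟩ := T.left_surj s
  ⟨⟨b, hb⟩, h⟩

variable {T}

theorem shift_mem_paths {c : ℤ → T.branch} (hc : c ∈ T.paths) (n : ℤ) :
    (fun t => c (t + n)) ∈ T.paths := by
  intro t
  have := hc (t + n)
  rwa [show t + n + 1 = t + 1 + n by ring] at this

theorem splice_mem_paths {c d : ℤ → T.branch} (hc : c ∈ T.paths) (hd : d ∈ T.paths) (t₀ : ℤ)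
    (h : T.right (c t₀) = T.left (d (t₀ + 1))) :
    (fun t => if t ≤ t₀ then c t else d t) ∈ T.paths := by
  intro t
  rcases lt_trichotomy t t₀ with ht | rfl | ht
  · have h1 : t + 1 ≤ t₀ := ht
    simpa [ht.le, h1] using hc t
  · simpa using h
  · have h1 : ¬ t ≤ t₀ := not_le.2 ht
    have h2 : ¬ t + 1 ≤ t₀ := by omega
    simpa only [h1, h2, if_false] using hd t

theorem pathsOn_mono {I J : Set ℤ} (h : I ⊆ J) : T.pathsOn I ≤ T.pathsOn J :=
  fun _ hc => ⟨hc.1, fun t ht => hc.2 t fun hI => ht (h hI)⟩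

theorem finite_pathsOn [Finite S] [Finite A] {I : Set ℤ} (hI : I.Finite) :
    Finite (T.pathsOn I) := by
  have := hI.to_subtype
  refine Finite.of_injective (β := I → T.branch) (fun c t => c.1 t) fun c d h => ?_
  ext t : 2
  by_cases ht : t ∈ I
  · exact congrFun h ⟨t, ht⟩
  · rw [c.2.2 t ht, d.2.2 t ht]

theorem Controllable.exists_path_left {l : ℕ} (h : T.Controllable l) (t : ℤ) (s : S) :
    ∃ c ∈ T.paths, T.left (c t) = s :=
  let ⟨c, hc, h1, _⟩ := h t s s
  ⟨c, hc, h1⟩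

theorem Controllable.exists_path {l : ℕ} (h : T.Controllable l) (t : ℤ) (b : T.branch) :
    ∃ c ∈ T.paths, c t = b := by
  obtain ⟨c, hc, hcb⟩ := h.exists_path_left t (T.left b)
  obtain ⟨d, hd, hdb⟩ := h.exists_path_left (t + 1) (T.right b)
  refine ⟨fun u => if u ≤ t - 1 then c u else if u ≤ t then b else d u, ?_, by simp⟩
  intro u
  have hc' := hc u
  have hd' := hd u
  rcases lt_trichotomy u t with hu | rfl | hu
  · rcases (Int.add_one_le_iff.2 hu).eq_or_lt with rfl | hu'
    · simpa [hcb] using hc'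
    · have h1 : u ≤ t - 1 := by omega
      have h2 : u + 1 ≤ t - 1 := by omega
      simpa only [h1, h2, if_true] using hc'
  · have h2 : ¬ u + 1 ≤ u - 1 := by omega
    simpa [h2] using hdb.symm
  · have h1 : ¬ u ≤ t - 1 := by omega
    have h2 : ¬ u + 1 ≤ t - 1 := by omega
    have h3 : ¬ u ≤ t := by omega
    have h4 : ¬ u + 1 ≤ t := by omega
    simpa only [h1, h2, h3, h4, if_false] using hd'

variable (T) in
theorem delta_eq (k : ℤ) : T.delta k =
    (T.pathsOn (Set.Icc 0 k)).map (Pi.evalMonoidHom (fun _ : ℤ => T.branch) 0) := by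
  apply le_antisymm
  · rintro b ⟨⟨c, ⟨hc, hc0⟩, rfl⟩, ⟨d, ⟨hd, hd0⟩, hdb⟩⟩
    simp only [Pi.evalMonoidHom_apply] at hdb ⊢
    -- The `Y` path is moved so that time -k - 1 becomes 0, and its past is replaced by the
    -- identity; membership in `X 0` makes the left state at time 0 trivial.
    refine ⟨fun t => if t ≤ -1 then 1 else d (t + (-k - 1)), ⟨?_, fun t ht => ?_⟩, ?_⟩
    · refine splice_mem_paths (one_mem _) (shift_mem_paths hd _) _ ?_
      have h := hc (-1)
      rw [hc0 (-1) (by simp)] at h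
      simpa [hdb] using h
    · by_cases h : t ≤ -1
      · simp [h]
      · simp only [h, if_false]
        refine hd0 _ ?_
        simp only [Set.mem_Icc, Set.mem_Iio] at ht ⊢
        omega
    · simp [hdb]
  · rintro _ ⟨c, ⟨hc, hc0⟩, rfl⟩
    refine ⟨⟨c, ⟨hc, fun t ht => hc0 t fun h => ht h.1⟩, rfl⟩,
      ⟨fun t => c (t + (k + 1)), ⟨shift_mem_paths hc _, fun t ht => hc0 _ fun h => ht ?_⟩, ?_⟩⟩
    · have := h.2
      simp only [Set.mem_Iio]
      omega
    · simp only [Pi.evalMonoidHom_apply]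
      congr 1
      ring

theorem delta_mono {i k : ℤ} (h : i ≤ k) : T.delta i ≤ T.delta k := by
  rw [delta_eq, delta_eq]
  exact Subgroup.map_mono (pathsOn_mono (Set.Icc_subset_Icc_right h))

theorem next_mono : Monotone T.next := fun _ _ h => Subgroup.comap_mono (Subgroup.map_mono h)

theorem iterate_next_mono (j : ℕ) {H K : Subgroup T.branch} (h : H ≤ K) :
    T.next^[j] H ≤ T.next^[j] K := next_mono.iterate j h

theorem Controllable.mem_Y_zero {l : ℕ} (h : T.Controllable l) {b : T.branch}
    (hb : T.right b = 1) : b ∈ T.Y 0 := by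
  obtain ⟨c, hc, hcb⟩ := h.exists_path (-1) b
  refine ⟨fun t => if t ≤ -1 then c t else 1, ⟨?_, fun t ht => ?_⟩, by simpa using hcb⟩
  · exact splice_mem_paths hc (one_mem _) _ (by simp [hcb, hb])
  · have : ¬ t ≤ -1 := fun h => ht (by simp only [Set.mem_Iio]; omega)
    simp [this]

theorem Controllable.mem_Y_succ {l : ℕ} (h : T.Controllable l) {b e : T.branch}
    (hbe : T.left e = T.right b) {i : ℕ} (he : e ∈ T.Y i) : b ∈ T.Y ((i + 1 : ℕ) : ℤ) := by
  obtain ⟨d, ⟨hd, hd0⟩, hde⟩ := he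
  simp only [Pi.evalMonoidHom_apply] at hde
  obtain ⟨c, hc, hcb⟩ := h.exists_path (-i - 2) b
  refine ⟨fun t => if t ≤ -i - 2 then c t else d t, ⟨?_, fun t ht => ?_⟩, ?_⟩
  · refine splice_mem_paths hc hd _ ?_
    rw [hcb, show (-i - 2 + 1 : ℤ) = -i - 1 by ring, hde, hbe]
  · have : ¬ t ≤ -i - 2 := fun h => ht (by simp only [Set.mem_Iio]; omega)
    simpa only [this, if_false] using hd0 t ht
  · have : (-((i + 1 : ℕ) : ℤ) - 1) = -i - 2 := by push_cast; ring
    simp only [Pi.evalMonoidHom_apply, this, le_refl, if_true, hcb]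

/-- Going back one branch moves from Y_i to Y_{i+1}; after j steps back the branch lies in X_0 ∩
Y_{j+i}. -/
theorem Controllable.mem_iterate_next_delta {l : ℕ} (h : T.Controllable l) (j : ℕ) :
    ∀ (i : ℕ) {e : T.branch}, e ∈ T.next^[j] (T.X 0) → e ∈ T.Y i →
      e ∈ T.next^[j] (T.delta ((j + i : ℕ) : ℤ)) := by
  induction j with
  | zero =>
    intro i e he hi
    rw [Nat.zero_add]
    exact ⟨he, hi⟩
  | succ j ih =>
    intro i e he hi
    rw [Function.iterate_succ_apply'] at he ⊢
    obtain ⟨b, hb, hbe⟩ := he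
    refine ⟨b, ?_, hbe⟩
    rw [show j + 1 + i = j + (i + 1) by ring]
    exact ih (i + 1) hb (h.mem_Y_succ hbe.symm hi)

theorem _root_.Subgroup.card_mul_relIndex_of_le {G : Type*} [Group G] {H K : Subgroup G}
    (h : H ≤ K) : Nat.card H * H.relIndex K = Nat.card K := by
  simpa only [Subgroup.relIndex_bot_left] using Subgroup.relIndex_mul_relIndex ⊥ H K bot_le h

theorem _root_.Subgroup.relIndex_map_map_of_inf_ker_le {G G' : Type*} [Group G] [Group G']
    (f : G →* G') {H K : Subgroup G} (hHK : H ≤ K) (h : K ⊓ f.ker ≤ H) :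
    (H.map f).relIndex (K.map f) = H.relIndex K := by
  rw [← Subgroup.relIndex_comap, ← Subgroup.inf_relIndex_right]
  congr 1
  apply le_antisymm
  · rintro x ⟨⟨y, hy, hyx⟩, hx⟩
    have : y⁻¹ * x ∈ H := h ⟨K.mul_mem (K.inv_mem (hHK hy)) hx, by
      simp [hyx]⟩
    simpa using mul_mem hy this
  · exact le_inf (Subgroup.le_comap_map f H) hHK

theorem relIndex_next {H K : Subgroup T.branch} (hHK : H ≤ K) (h : K ⊓ T.right.ker ≤ H) :
    (T.next H).relIndex (T.next K) = H.relIndex K := by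
  rw [next, next, Subgroup.relIndex_comap,
    Subgroup.map_comap_eq_self_of_surjective T.left_surjective,
    Subgroup.relIndex_map_map_of_inf_ker_le _ hHK h]

/-- `next` preserves the index if the smaller group contains every branch of the larger one with
trivial right state. Such a branch of N^j(Δ_k) lies in Y_0, hence in N^j(Δ_j), and j ≤ k - 1 at each
step of the induction. -/
theorem Controllable.cardQ_eq {l : ℕ} (h : T.Controllable l) {j k : ℕ} (hjk : j ≤ k) :
    T.cardQ j k = T.cardQ 0 k := by
  induction j with
  | zero => rfl
  | succ j ih =>
    rw [← ih (by omega), cardQ, cardQ, Function.iterate_succ_apply', Function.iterate_succ_apply']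
    refine relIndex_next (iterate_next_mono j (delta_mono (by omega))) ?_
    rintro x ⟨hx, hx1⟩
    have h1 := h.mem_iterate_next_delta j 0 (iterate_next_mono j inf_le_left hx)
      (by exact_mod_cast h.mem_Y_zero hx1)
    exact iterate_next_mono j (delta_mono (by omega)) h1

theorem one_le_cardQ [Finite S] [Finite A] (j k : ℕ) : 1 ≤ T.cardQ j k :=
  Nat.one_le_iff_ne_zero.2 Subgroup.index_ne_zero_of_finite

/-! ### Orders of the groups of finite paths -/

variable (T)

/-- The subgroup generated by `C_{[0,k)}` and `C_{(0,k]}`; its cosets in `C_{[0,k]}` are the ones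
represented by generators. -/
def generatorKernel (k : ℕ) : Subgroup (ℤ → T.branch) :=
  T.pathsOn (Set.Ico 0 (k : ℤ)) ⊔ T.pathsOn (Set.Ioc 0 (k : ℤ))

theorem generatorKernel_le (k : ℕ) : T.generatorKernel k ≤ T.pathsOn (Set.Icc 0 (k : ℤ)) :=
  sup_le (pathsOn_mono Set.Ico_subset_Icc_self) (pathsOn_mono Set.Ioc_subset_Icc_self)

theorem Ico_zero_eq_Icc (k : ℤ) : Set.Ico 0 k = Set.Icc 0 (k - 1) := by
  ext t; simp only [Set.mem_Ico, Set.mem_Icc]; omega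

theorem mem_pathsOn_Ioc_iff {k : ℤ} {c : ℤ → T.branch} :
    c ∈ T.pathsOn (Set.Ioc 0 k) ↔ c ∈ T.pathsOn (Set.Icc 0 k) ∧ c 0 = 1 := by
  constructor
  · intro h
    exact ⟨pathsOn_mono Set.Ioc_subset_Icc_self h, h.2 0 (by simp)⟩
  · rintro ⟨⟨h, h0⟩, h1⟩
    refine ⟨h, fun t ht => ?_⟩
    by_cases ht0 : t = 0
    · rw [ht0, h1]
    · refine h0 t fun hI => ht ⟨lt_of_le_of_ne hI.1 (Ne.symm ht0), hI.2⟩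

/-- Evaluation at time 0 maps C_{[0,k]} onto Δ_k with kernel C_{(0,k]}, and the preimage of Δ_{k-1}
is the generator kernel. -/
theorem relIndex_generatorKernel (k : ℕ) :
    (T.generatorKernel k).relIndex (T.pathsOn (Set.Icc 0 (k : ℤ))) = T.cardQ 0 k := by
  simp only [cardQ, Function.iterate_zero, id, delta_eq]
  rw [← Subgroup.relIndex_comap, ← Subgroup.inf_relIndex_right]
  rw [← Subgroup.inf_relIndex_right (Subgroup.comap _ _)]
  congr 1
  rw [inf_eq_left.2 (T.generatorKernel_le k)]
  apply le_antisymm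
  · refine le_inf (sup_le ?_ ?_) (T.generatorKernel_le k)
    · rw [Ico_zero_eq_Icc]
      exact Subgroup.le_comap_map _ _
    · intro c hc
      exact ⟨1, one_mem _, ((T.mem_pathsOn_Ioc_iff.1 hc).2).symm⟩
  · rintro c ⟨⟨d, hd, hdc⟩, hc⟩
    simp only [Pi.evalMonoidHom_apply] at hdc
    rw [← Ico_zero_eq_Icc] at hd
    have h1 : d⁻¹ * c ∈ T.pathsOn (Set.Ioc 0 (k : ℤ)) :=
      T.mem_pathsOn_Ioc_iff.2 ⟨mul_mem (inv_mem (pathsOn_mono Set.Ico_subset_Icc_self hd)) hc, by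
        simp [hdc]⟩
    rw [← mul_inv_cancel_left d c]
    exact mul_mem (Subgroup.mem_sup_left hd) (Subgroup.mem_sup_right h1)

theorem card_pathsOn_Ioc (k : ℤ) :
    Nat.card (T.pathsOn (Set.Ioc 0 (k + 1))) = Nat.card (T.pathsOn (Set.Icc 0 k)) := by
  refine Nat.card_congr
    { toFun := fun c => ⟨fun t => c.1 (t + 1), shift_mem_paths c.2.1 _, fun t ht =>
        c.2.2 _ fun h => ht ?_⟩
      invFun := fun c => ⟨fun t => c.1 (t + -1), shift_mem_paths c.2.1 _, fun t ht =>
        c.2.2 _ fun h => ht ?_⟩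
      left_inv := fun c => by ext t : 2; simp
      right_inv := fun c => by ext t : 2; simp }
  · simp only [Set.mem_Ioc, Set.mem_Icc] at h ⊢; omega
  · simp only [Set.mem_Ioc, Set.mem_Icc] at h ⊢; omega

/-- Evaluation at time 0 has image Δ_{k+1} and kernel C_{(0,k+1]}, a shift of C_{[0,k]}. -/
theorem card_pathsOn_Icc (k : ℤ) : Nat.card (T.pathsOn (Set.Icc 0 (k + 1))) =
    Nat.card (T.delta (k + 1)) * Nat.card (T.pathsOn (Set.Icc 0 k)) := by
  let P := T.pathsOn (Set.Icc 0 (k + 1))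
  let f : P →* T.branch := (Pi.evalMonoidHom (fun _ : ℤ => T.branch) 0).comp P.subtype
  have hker : f.ker = (T.pathsOn (Set.Ioc 0 (k + 1))).subgroupOf P := by
    ext c
    rw [Subgroup.mem_subgroupOf, mem_pathsOn_Ioc_iff]
    exact ⟨fun h => ⟨c.2, h⟩, fun h => h.2⟩
  have hrange : f.range = T.delta (k + 1) := by
    rw [delta_eq, MonoidHom.range_comp, Subgroup.range_subtype]
  rw [← card_pathsOn_Ioc T k, ← hrange, ← Subgroup.index_ker, mul_comm,
    ← Nat.card_congr (Subgroup.subgroupOfEquivOfLe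
      (pathsOn_mono (T := T) (Set.Ioc_subset_Icc_self (a := (0 : ℤ)) (b := k + 1)))).toEquiv,
    ← hker]
  exact (Subgroup.card_mul_index f.ker).symm

theorem pathsOn_empty : T.pathsOn ∅ = ⊥ :=
  eq_bot_iff.2 fun _ hc => funext fun t => hc.2 t (Set.notMem_empty t)

theorem card_delta (k : ℕ) :
    Nat.card (T.delta k) = ∏ i ∈ Finset.range (k + 1), T.cardQ 0 i := by
  induction k with
  | zero =>
    have : T.delta (((0 : ℕ) : ℤ) - 1) = ⊥ := by
      rw [delta_eq, Set.Icc_eq_empty (by simp), pathsOn_empty, Subgroup.map_bot]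
    rw [Finset.prod_range_one, cardQ]
    simp only [Function.iterate_zero, id, this, Subgroup.relIndex_bot_left]
  | succ k ih =>
    rw [Finset.prod_range_succ, ← ih, cardQ]
    simp only [Function.iterate_zero, id, Nat.cast_add, Nat.cast_one, add_sub_cancel_right]
    exact (Subgroup.card_mul_relIndex_of_le (delta_mono (by omega))).symm

theorem card_pathsOn (k : ℕ) : Nat.card (T.pathsOn (Set.Icc 0 (k : ℤ))) =
    ∏ i ∈ Finset.range (k + 1), T.cardQ 0 i ^ (k - i + 1) := by
  induction k with
  | zero =>
    have h := T.card_pathsOn_Icc (-1)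
    have h0 := T.card_delta 0
    rw [Set.Icc_eq_empty (a := (0 : ℤ)) (b := -1) (by simp), pathsOn_empty, Subgroup.card_bot,
      mul_one] at h
    rw [Finset.prod_range_one] at h0 ⊢
    rw [Nat.sub_self, zero_add, pow_one, ← h0]
    exact h
  | succ k ih =>
    rw [Nat.cast_add, Nat.cast_one, card_pathsOn_Icc, ih]
    have := T.card_delta (k + 1)
    rw [Nat.cast_add, Nat.cast_one] at this
    rw [this, Finset.prod_range_succ, Finset.prod_range_succ _ (k + 1), mul_right_comm,
      ← Finset.prod_mul_distrib, Nat.sub_self, zero_add, pow_one]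
    congr 1
    refine Finset.prod_congr rfl fun i hi => ?_
    rw [Finset.mem_range] at hi
    rw [← pow_succ', show k + 1 - i = k - i + 1 by omega]

theorem card_generatorKernel [Finite S] [Finite A] (k : ℕ) :
    Nat.card (T.generatorKernel k) = ∏ i ∈ Finset.range k, T.cardQ 0 i ^ (k - i + 1) := by
  refine Nat.eq_of_mul_eq_mul_right (T.one_le_cardQ 0 k) ?_
  have h := Subgroup.card_mul_relIndex_of_le (T.generatorKernel_le k)
  rwa [relIndex_generatorKernel, card_pathsOn, Finset.prod_range_succ, Nat.sub_self, zero_add,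
    pow_one] at h

theorem encard_generatorBases_le [Finite S] [Finite A] (ℓ : ℕ) :
    (T.generatorBases ℓ).encard ≤ ((∏ k ∈ Finset.range (ℓ + 1),
      (∏ i ∈ Finset.range k, T.cardQ 0 i ^ (k - i + 1)) ^ (T.cardQ 0 k - 1) : ℕ) : ℕ∞) := by
  have hfin : ∀ k : ℕ, Finite (T.pathsOn (Set.Icc 0 (k : ℤ))) := fun k =>
    finite_pathsOn (Set.finite_Icc _ _)
  have hcard := fun k : ℕ => card_transversals_le _ _ (T.generatorKernel_le k)
  let D := ∀ k : Fin (ℓ + 1), {G // T.IsGeneratorSet k G}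
  have hD : ∀ k : ℕ, Finite {G // T.IsGeneratorSet k G} := fun k => (hcard k).1
  let F : D → (TriIndex ℓ → Set T.branch) := fun G p =>
    (fun g => g (p.1.1 : ℤ)) '' (G ⟨p.1.2, Nat.lt_succ_of_le p.2.2⟩).1
  have hsub : T.generatorBases ℓ ⊆ Set.range F := by
    rintro R ⟨G, hG, hR⟩
    exact ⟨fun k => ⟨G k, hG k (Nat.le_of_lt_succ k.2)⟩, funext fun p => (hR p).symm⟩
  have hrange : (Set.range F).encard ≤ Nat.card D := by
    rw [← Set.image_univ]
    refine (Set.encard_image_le _ _).trans ?_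
    rw [Set.encard_univ, ENat.card_eq_coe_natCard]
  refine (Set.encard_le_encard hsub).trans (hrange.trans (Nat.cast_le.2 ?_))
  rw [Nat.card_pi, ← Fin.prod_univ_eq_prod_range fun k =>
    (∏ i ∈ Finset.range k, T.cardQ 0 i ^ (k - i + 1)) ^ (T.cardQ 0 k - 1)]
  refine Finset.prod_le_prod' fun k _ => ?_
  rw [← card_generatorKernel, ← relIndex_generatorKernel]
  exact (hcard k).2

end GroupTrellis

/-! ### Conclusion -/

/-- The sizes |Q_{j,k}| and |Q_{0,k}| are only propositionally equal; with the sizes as variables,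
the graphs can be identified by substitution. -/
theorem card_aut_registerGraph_congr {ℓ : ℕ} {f f' : TriIndex ℓ → ℕ} {g g' : TailIndex ℓ → ℕ}
    (hf : f = f') (hg : g = g') :
    Nat.card (registerGraph f g).Aut = Nat.card (registerGraph f' g').Aut := by
  subst hf hg; rfl

theorem GroupTrellis.Controllable.card_aut_shiftGraph {S A : Type*} [Group S] [Group A] [Finite S]
    [Finite A] {T : GroupTrellis S A} {l : ℕ} (h : T.Controllable l) (ℓ : ℕ) :
    Nat.card (T.shiftGraph ℓ).Aut = ∏ k ∈ Finset.range (ℓ + 1),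
      (T.cardQ 0 k).factorial ^ (∏ k' ∈ Finset.Ioc k ℓ, T.cardQ 0 k' ^ (k' - k + 1)) := by
  have hf : (fun p : TriIndex ℓ => T.cardQ p.1.1 p.1.2) = fun p => T.cardQ 0 p.1.2 :=
    funext fun p => h.cardQ_eq p.2.1
  have hg : (fun p : TailIndex ℓ => T.cardQ (p.1.1 + 1) p.1.2) = fun p => T.cardQ 0 p.1.2 :=
    funext fun p => h.cardQ_eq p.2.1
  exact (card_aut_registerGraph_congr hf hg).trans
    (ShiftRegister.card_aut (m := T.cardQ 0) fun k => T.one_le_cardQ 0 k)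

theorem mainTheorem9 {S A : Type*} [Group S] [Group A] [Finite S] [Finite A]
    (T : GroupTrellis S A) (ℓ : ℕ) (hℓ : IsLeast {l : ℕ | 0 < l ∧ T.Controllable l} ℓ) :
    (T.generatorBases ℓ).encard ≤ ((Nat.card (T.shiftGraph ℓ).Aut : ℕ) : ℕ∞) ∧
    (T.generatorBases ℓ).encard ≤
      ((∏ k ∈ Finset.range (ℓ + 1),
        (T.cardQ 0 k).factorial ^ (∏ k' ∈ Finset.Ioc k ℓ, T.cardQ 0 k' ^ (k' - k)) : ℕ) : ℕ∞) ∧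
    Nat.card (T.shiftGraph ℓ).Aut =
      ∏ k ∈ Finset.range (ℓ + 1),
        (T.cardQ 0 k).factorial ^ (∏ k' ∈ Finset.Ioc k ℓ, T.cardQ 0 k' ^ (k' - k + 1)) ∧
    (T.vectorBasis '' T.generatorBases ℓ).encard ≤ (T.generatorBases ℓ).encard := by
  have hm : ∀ k, 1 ≤ T.cardQ 0 k := fun k => T.one_le_cardQ 0 k
  have haut := hℓ.1.2.card_aut_shiftGraph ℓ
  have hle : (T.generatorBases ℓ).encard ≤ ((∏ k ∈ Finset.range (ℓ + 1),
      (T.cardQ 0 k).factorial ^ (∏ k' ∈ Finset.Ioc k ℓ, T.cardQ 0 k' ^ (k' - k)) : ℕ) : ℕ∞) := by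
    refine (T.encard_generatorBases_le ℓ).trans (Nat.cast_le.2 ?_)
    rw [prod_prod_pow_eq_prod_pow_sum]
    exact prod_pow_sum_le_prod_factorial_pow _ hm ℓ
  refine ⟨hle.trans (Nat.cast_le.2 ?_), hle, haut, Set.encard_image_le _ _⟩
  rw [haut]
  refine Finset.prod_le_prod' fun k _ => Nat.pow_le_pow_right (Nat.factorial_pos _) ?_
  exact Finset.prod_le_prod' fun k' _ => Nat.pow_le_pow_right (hm k') (Nat.le_succ _)
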